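/- All spaces are $T_0$, ordered by the specialization order $x\sqsubseteq y \iff x\in\overline{\{y\}}$; directed sets are nonempty. A directed set $D$, viewed as a net indexed by itself, converges to $x$ ($D\to x$) if it is eventually in every open neighbourhood of $x$. A set $U\subseteq X$ is directed-open if $D\cap U\neq\emptyset$ whenever $D$ is directed, $D\to x$ and $x\in U$; $\mathcal{D}X$ is the set $X$ with the topology of directed-open sets, and $X$ is a directed space if every directed-open set is open. In a directed space, $x\ll y$ means that every directed $D\to y$ contains some $d$ with $x\sqsubseteq d$; $X$ is a continuous space if it is a directed space and for every $x$ there is a directed $D\subseteq\{y: y\ll x\}$ with $D\to x$. A map $f:X\to Y$ between continuous spaces is way-below preserving if it is continuous and $x\ll y$ implies $f(x)\ll f(y)$. Let $\Sigma$ be a finitary signature (operation symbols $i\in I$ with arities $n_i\in\mathbb{N}$) and $\mathcal{E}$ a set of inequalities $\tau_1\le\tau_2$ between $\Sigma$-terms over a countably infinite set of variables. A dtop-algebra is a directed space $A$ with continuous operations $f_i:A^{n_i}\to A$, where $A^{n}=\mathcal{D}(A\times\dots\times A)$; homomorphisms are continuous maps commuting with the operations. $\mathbf{DTop}(\Sigma,\mathcal{E})$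 is the category of dtop-algebras in which all inequalities of $\mathcal{E}$ hold (with respect to $\sqsubseteq$, for all assignments of the variables). A free algebra over a directed space $X$ is an object $F(X)$ of $\mathbf{DTop}(\Sigma,\mathcal{E})$, with carrier space $UF(X)$, together with a continuous map $\eta:X\to UF(X)$ (the unit) such that for every object $B$ and every continuous map $f:X\to B$ there is a unique homomorphism $\bar f:F(X)\to B$ with $\bar f\circ\eta=f$. **Proposition.** Let $X$ be a continuous space. Then the free algebra $F(X)$ over $X$ with respect to $\mathbf{DTop}(\Sigma,\mathcal{E})$ exists; moreover, for every such free algebra, its carrier $UF(X)$ is a continuous space, and the unit $\eta:X\to UF(X)$ as well as all $\Sigma$-operations $f_i:UF(X)^{n_i}\to UF(X)$ of $F(X)$ are way-below preserving. -/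

import Mathlib

universe u v

namespace DTop

section Spaces

variable {X : Type u} [TopologicalSpace X]

/-- The specialization order `x ⊑ y` of a topological space. -/
def SpecLE (x y : X) : Prop := x ∈ closure ({y} : Set X)

/-- Directed (in particular nonempty) subsets with respect to the specialization order. -/
def IsDirectedSet (D : Set X) : Prop := D.Nonempty ∧ DirectedOn SpecLE D

/-- `D → x`: the monotone net `(d)_{d ∈ D}` is eventually in every open neighbourhood of `x`. -/
def ConvergesTo (D : Set X) (x : X) : Prop :=
  ∀ U : Set X, IsOpen U → x ∈ U → ∃ d ∈ D, ∀ e ∈ D, SpecLE d e → e ∈ U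

/-- Directed-open sets. -/
def IsDirectedOpen (U : Set X) : Prop :=
  ∀ (D : Set X) (x : X), IsDirectedSet D → ConvergesTo D x → x ∈ U → (D ∩ U).Nonempty

theorem SpecLE.mem_of_isOpen {x y : X} (h : SpecLE x y) {U : Set X} (hU : IsOpen U)
    (hx : x ∈ U) : y ∈ U := by
  obtain ⟨z, hz, rfl⟩ := mem_closure_iff.1 h U hU hx
  exact hz

theorem SpecLE.refl (x : X) : SpecLE x x := subset_closure rfl

theorem IsDirectedOpen.mem_of_specLE {U : Set X} (hU : IsDirectedOpen U) {x y : X}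
    (h : SpecLE x y) (hx : x ∈ U) : y ∈ U := by
  obtain ⟨z, rfl, hz⟩ := hU {y} x
    ⟨⟨y, rfl⟩, by rintro a rfl b rfl; exact ⟨_, rfl, SpecLE.refl _, SpecLE.refl _⟩⟩
    (fun V hV hxV => ⟨y, rfl, by rintro e rfl _; exact h.mem_of_isOpen hV hxV⟩) hx
  exact hz

variable (X) in
/-- The topology of all directed-open sets of `X`, i.e. the space `𝒟X`. -/
@[reducible] def directedTopology : TopologicalSpace X where
  IsOpen := IsDirectedOpen
  isOpen_univ := fun D _ hD _ _ => by simpa using hD.1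
  isOpen_inter := by
    rintro U V hU hV D x hD hDx ⟨hxU, hxV⟩
    obtain ⟨a, haD, haU⟩ := hU D x hD hDx hxU
    obtain ⟨b, hbD, hbV⟩ := hV D x hD hDx hxV
    obtain ⟨c, hcD, hac, hbc⟩ := hD.2 a haD b hbD
    exact ⟨c, hcD, hU.mem_of_specLE hac haU, hV.mem_of_specLE hbc hbV⟩
  isOpen_sUnion := by
    rintro s hs D x hD hDx ⟨U, hUs, hxU⟩
    obtain ⟨a, haD, haU⟩ := hs U hUs D x hD hDx hxU
    exact ⟨a, haD, U, hUs, haU⟩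

variable (X) in
/-- Directed spaces: `T₀` spaces in which every directed-open set is open. -/
def IsDirectedSpace : Prop := T0Space X ∧ ∀ U : Set X, IsDirectedOpen U → IsOpen U

/-- The way-below relation (`d`-approximation) `x ≪ y`. -/
def WayBelow (x y : X) : Prop :=
  ∀ D : Set X, IsDirectedSet D → ConvergesTo D y → ∃ d ∈ D, SpecLE x d

variable (X) in
/-- Continuous spaces. -/
def IsContinuousSpace : Prop :=
  IsDirectedSpace X ∧
    ∀ x : X, ∃ D : Set X, IsDirectedSet D ∧ D ⊆ {y | WayBelow y x} ∧ ConvergesTo D x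

end Spaces

/-- Way-below preserving maps: continuous maps between continuous spaces that preserve `≪`. -/
structure WayBelowPreserving {X : Type u} {Y : Type v} [TopologicalSpace X] [TopologicalSpace Y]
    (f : X → Y) : Prop where
  source : IsContinuousSpace X
  target : IsContinuousSpace Y
  continuous : Continuous f
  wayBelow : ∀ x y : X, WayBelow x y → WayBelow (f x) (f y)

/-- The `n`-fold power `X ⊗ ⋯ ⊗ X` in the category of directed spaces: the set `Xⁿ` with the
directed-open sets of the topological product as open sets. -/
def DirectedPower (X : Type u) (n : ℕ) : Type u := Fin n → X

instance (X : Type u) [TopologicalSpace X] (n : ℕ) : TopologicalSpace (DirectedPower X n) :=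
  directedTopology (Fin n → X)

/-- A finitary signature: a set of operation symbols with finite arities. -/
structure Signature where
  /-- operation symbols -/
  Op : Type u
  /-- arity of each symbol -/
  arity : Op → ℕ

/-- The term algebra over a set `V` of variables. -/
inductive Signature.Term (S : Signature.{u}) (V : Type v) : Type (max u v)
  | var : V → Signature.Term S V
  | app : (i : S.Op) → (Fin (S.arity i) → Signature.Term S V) → Signature.Term S V

/-- A dtop-algebra: a directed space with continuous operations, where the powers are taken in
the category of directed spaces. -/
structure Algebra (S : Signature.{u}) where
  carrier : Type u
  [top : TopologicalSpace carrier]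
  isDirectedSpace : IsDirectedSpace carrier
  op : (i : S.Op) → DirectedPower carrier (S.arity i) → carrier
  continuous_op : ∀ i, Continuous (op i)

namespace Algebra

variable {S : Signature.{u}}

instance (A : Algebra S) : TopologicalSpace A.carrier := A.top

/-- The homomorphic extension of `h : V → A` to the term algebra. -/
def eval (A : Algebra S) {V : Type v} (h : V → A.carrier) : S.Term V → A.carrier
  | .var x => h x
  | .app i t => A.op i (fun j => A.eval h (t j))

/-- All inequalities `τ₁ ≤ τ₂`, `(τ₁, τ₂) ∈ E`, hold in `A`; the set of variables is `ℕ`. -/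
def Satisfies (A : Algebra S) (E : Set (S.Term ℕ × S.Term ℕ)) : Prop :=
  ∀ p ∈ E, ∀ h : ℕ → A.carrier, SpecLE (A.eval h p.1) (A.eval h p.2)

/-- Homomorphisms of dtop-algebras are continuous and commute with the operations. -/
def IsHom (A B : Algebra S) (h : A.carrier → B.carrier) : Prop :=
  Continuous h ∧
    ∀ (i : S.Op) (a : DirectedPower A.carrier (S.arity i)),
      h (A.op i a) = B.op i (fun j => h (a j))

/-- `A` with unit `η` is the free algebra over the space `X` with respect to `DTop(S, E)`. -/
def IsFree (E : Set (S.Term ℕ × S.Term ℕ)) {X : Type u} [TopologicalSpace X] (A : Algebra S)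
    (η : X → A.carrier) : Prop :=
  A.Satisfies E ∧ Continuous η ∧
    ∀ B : Algebra S, B.Satisfies E → ∀ f : X → B.carrier, Continuous f →
      ∃! h : A.carrier → B.carrier, IsHom A B h ∧ h ∘ η = f

end Algebra

end DTop

/-! The free algebra is built from terms over `X`. Two relations on terms are used: `Approx` (same
shape, variables way below each other) and the preorder `Le` generated by `⊑`, the operations and
`E`. Open sets of terms are the `Le`-upper sets containing an approximant of each member; the T₀
quotient is the free algebra.

The crux is `Le.exists_approx`: an approximant of `t` lies `Le`-below some approximant of any `u`
above `t`. With interpolation this makes `{t | Below E s t}` open (`isOpen_below`), so `Approx`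
becomes `≪` in the quotient, while every term is by construction the limit of its approximants.
Hence the quotient is a continuous space. A continuous map from `X` to an algebra extends by
evaluation, which is continuous because it preserves these limits (`convergesTo_eval_approx`).

Any free algebra is isomorphic to this one, so its evaluation map is surjective and inducing;
continuity of the space and preservation of `≪` are read off from terms. -/

namespace DTop

/-! ### Specialization order, directed convergence and the way-below relation -/

section Spaces

variable {X : Type u} [TopologicalSpace X]

theorem specLE_iff_specializes {x y : X} : SpecLE x y ↔ y ⤳ x :=
  specializes_iff_mem_closure.symm

theorem SpecLE.trans {x y z : X} (h : SpecLE x y) (h' : SpecLE y z) : SpecLE x z :=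
  specLE_iff_specializes.2
    ((specLE_iff_specializes.1 h').trans (specLE_iff_specializes.1 h))

theorem SpecLE.antisymm [T0Space X] {x y : X} (h : SpecLE x y) (h' : SpecLE y x) : x = y :=
  ((specLE_iff_specializes.1 h').antisymm (specLE_iff_specializes.1 h)).eq

theorem SpecLE.map {Y : Type v} [TopologicalSpace Y] {f : X → Y} (hf : Continuous f) {x y : X}
    (h : SpecLE x y) : SpecLE (f x) (f y) :=
  specLE_iff_specializes.2 ((specLE_iff_specializes.1 h).map hf)

theorem convergesTo_iff {D : Set X} {x : X} :
    ConvergesTo D x ↔ ∀ U : Set X, IsOpen U → x ∈ U → ∃ d ∈ D, d ∈ U := by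
  constructor
  · intro h U hU hx
    obtain ⟨d, hd, hdU⟩ := h U hU hx
    exact ⟨d, hd, hdU d hd (SpecLE.refl d)⟩
  · intro h U hU hx
    obtain ⟨d, hd, hdU⟩ := h U hU hx
    exact ⟨d, hd, fun e _ hde => hde.mem_of_isOpen hU hdU⟩

theorem isDirectedSet_singleton (x : X) : IsDirectedSet ({x} : Set X) :=
  ⟨⟨x, rfl⟩, by rintro a rfl b rfl; exact ⟨_, rfl, SpecLE.refl _, SpecLE.refl _⟩⟩

theorem ConvergesTo.mono {D : Set X} {x y : X} (h : ConvergesTo D y) (hxy : SpecLE x y) :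
    ConvergesTo D x :=
  fun U hU hx => h U hU (hxy.mem_of_isOpen hU hx)

theorem WayBelow.specLE {x y : X} (h : WayBelow x y) : SpecLE x y := by
  obtain ⟨_, rfl, hd⟩ := h {y} (isDirectedSet_singleton y)
    (convergesTo_iff.2 fun _ _ hy => ⟨y, rfl, hy⟩)
  exact hd

theorem WayBelow.trans_specLE {x y z : X} (h : WayBelow x y) (h' : SpecLE y z) : WayBelow x z :=
  fun D hD hDz => h D hD (hDz.mono h')

theorem SpecLE.trans_wayBelow {x y z : X} (h : SpecLE x y) (h' : WayBelow y z) : WayBelow x z := by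
  intro D hD hDz
  obtain ⟨d, hd, hyd⟩ := h' D hD hDz
  exact ⟨d, hd, h.trans hyd⟩

/-- A finite family of elements of a directed class has an upper bound in that class. -/
theorem exists_forall_rel_of_directed {α : Type u} {r : α → α → Prop}
    (htrans : ∀ {a b c}, r a b → r b c → r a c) {P : α → Prop} (hne : ∃ a, P a)
    (hdir : ∀ a b, P a → P b → ∃ c, P c ∧ r a c ∧ r b c) {n : ℕ} (F : Fin n → α)
    (hF : ∀ j, P (F j)) : ∃ c, P c ∧ ∀ j, r (F j) c := by
  induction n with
  | zero =>
    obtain ⟨a, ha⟩ := hne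
    exact ⟨a, ha, fun j => j.elim0⟩
  | succ n ih =>
    obtain ⟨c, hc, hcF⟩ := ih (fun j => F j.succ) fun j => hF j.succ
    obtain ⟨d, hd, hcd, hd0⟩ := hdir c (F 0) hc (hF 0)
    exact ⟨d, hd, fun j => Fin.cases hd0 (fun k => htrans (hcF k) hcd) j⟩

theorem IsDirectedSet.exists_forall_specLE {D : Set X} (hD : IsDirectedSet D) {n : ℕ}
    (F : Fin n → X) (hF : ∀ j, F j ∈ D) : ∃ d ∈ D, ∀ j, SpecLE (F j) d :=
  exists_forall_rel_of_directed (r := SpecLE) (P := fun x => x ∈ D) SpecLE.trans hD.1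
    (fun a b ha hb => hD.2 a ha b hb) F hF

namespace IsContinuousSpace

theorem isDirectedSet_wayBelow (hX : IsContinuousSpace X) (x : X) :
    IsDirectedSet {y | WayBelow y x} := by
  obtain ⟨D, hD, hDx, hDc⟩ := hX.2 x
  refine ⟨hD.1.mono hDx, fun a ha b hb => ?_⟩
  obtain ⟨d, hd, had⟩ := ha D hD hDc
  obtain ⟨e, he, hbe⟩ := hb D hD hDc
  obtain ⟨c, hc, hdc, hec⟩ := hD.2 d hd e he
  exact ⟨c, hDx hc, had.trans hdc, hbe.trans hec⟩

theorem convergesTo_wayBelow (hX : IsContinuousSpace X) (x : X) :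
    ConvergesTo {y | WayBelow y x} x := by
  obtain ⟨D, -, hDx, hDc⟩ := hX.2 x
  refine convergesTo_iff.2 fun U hU hx => ?_
  obtain ⟨d, hd, hdU⟩ := convergesTo_iff.1 hDc U hU hx
  exact ⟨d, hDx hd, hdU⟩

/-- The elements reachable by two way-below steps under `y` already form a directed set converging
to `y`, so one of them lies above `x`. -/
theorem interpolation (hX : IsContinuousSpace X) {x y : X} (h : WayBelow x y) :
    ∃ z, WayBelow x z ∧ WayBelow z y := by
  have hdir : IsDirectedSet {w : X | ∃ z, WayBelow w z ∧ WayBelow z y} := by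
    constructor
    · obtain ⟨z, hz⟩ := (hX.isDirectedSet_wayBelow y).1
      obtain ⟨w, hw⟩ := (hX.isDirectedSet_wayBelow z).1
      exact ⟨w, z, hw, hz⟩
    · rintro a ⟨c, hac, hcy⟩ b ⟨d, hbd, hdy⟩
      obtain ⟨e, he, hce, hde⟩ := (hX.isDirectedSet_wayBelow y).2 c hcy d hdy
      obtain ⟨w, hw, haw, hbw⟩ := (hX.isDirectedSet_wayBelow e).2 a (hac.trans_specLE hce) b
        (hbd.trans_specLE hde)
      exact ⟨w, ⟨e, hw, he⟩, haw, hbw⟩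
  have hconv : ConvergesTo {w : X | ∃ z, WayBelow w z ∧ WayBelow z y} y := by
    refine convergesTo_iff.2 fun U hU hy => ?_
    obtain ⟨z, hz, hzU⟩ := convergesTo_iff.1 (hX.convergesTo_wayBelow y) U hU hy
    obtain ⟨w, hw, hwU⟩ := convergesTo_iff.1 (hX.convergesTo_wayBelow z) U hU hzU
    exact ⟨w, ⟨z, hw, hz⟩, hwU⟩
  obtain ⟨w, ⟨z, hwz, hzy⟩, hxw⟩ := h _ hdir hconv
  exact ⟨z, hxw.trans_wayBelow hwz, hzy⟩

end IsContinuousSpace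

theorem specLE_pi_iff {n : ℕ} {a b : Fin n → X} :
    SpecLE a b ↔ ∀ j, SpecLE (a j) (b j) := by
  simp only [specLE_iff_specializes, specializes_pi]

theorem isDirectedOpen_of_isOpen {U : Set X} (hU : IsOpen U) : IsDirectedOpen U := by
  intro D x _ hDx hx
  obtain ⟨d, hd, hdU⟩ := convergesTo_iff.1 hDx U hU hx
  exact ⟨d, hd, hdU⟩

end Spaces

/-! ### Finite powers of directed spaces -/

namespace DirectedPower

variable {X : Type u} [TopologicalSpace X] {n : ℕ}

theorem isOpen_of_isOpen_pi {U : Set (Fin n → X)} (hU : IsOpen U) :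
    IsOpen (X := DirectedPower X n) U :=
  isDirectedOpen_of_isOpen hU

theorem continuous_of_continuous_pi {Y : Type v} [TopologicalSpace Y] {f : (Fin n → X) → Y}
    (hf : Continuous f) : Continuous (X := DirectedPower X n) f :=
  ⟨fun _ hU => isOpen_of_isOpen_pi (hU.preimage hf)⟩

/-- The specialization order of a power is the pointwise one. -/
theorem specLE_iff {a b : DirectedPower X n} : SpecLE a b ↔ ∀ j, SpecLE (a j) (b j) := by
  constructor
  · intro h j
    exact h.map (continuous_of_continuous_pi (continuous_apply j))
  · intro h
    exact mem_closure_iff.2 fun U hU ha =>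
      ⟨b, IsDirectedOpen.mem_of_specLE (X := Fin n → X) hU (specLE_pi_iff.2 h) ha, rfl⟩

theorem isDirectedSet_iff {D : Set (DirectedPower X n)} :
    IsDirectedSet D ↔ IsDirectedSet (X := Fin n → X) D := by
  simp only [IsDirectedSet, DirectedOn, specLE_iff]
  refine and_congr Iff.rfl (forall₂_congr fun a _ => forall₂_congr fun b _ => ?_)
  refine exists_congr fun c => and_congr Iff.rfl (and_congr ?_ ?_) <;>
    exact specLE_pi_iff.symm

/-- Passing to directed-open sets adds no new condition on convergence of directed sets, so
convergence in a power can be tested on open boxes. -/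
theorem convergesTo_iff_pi {D : Set (DirectedPower X n)} (hD : IsDirectedSet D)
    {a : DirectedPower X n} : ConvergesTo D a ↔ ConvergesTo (X := Fin n → X) D a := by
  constructor
  · intro h
    exact convergesTo_iff.2 fun U hU ha => convergesTo_iff.1 h U (isOpen_of_isOpen_pi hU) ha
  · intro h
    exact convergesTo_iff.2 fun U hU ha => hU D a (isDirectedSet_iff.1 hD) h ha

/-- A product of convergent directed sets is a convergent directed set. -/
theorem isDirectedSet_pi {D : Fin n → Set X} (hD : ∀ j, IsDirectedSet (D j)) :
    IsDirectedSet {c : DirectedPower X n | ∀ j, c j ∈ D j} := by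
  constructor
  · choose c hc using fun j => (hD j).1
    exact ⟨c, hc⟩
  · intro a ha b hb
    choose c hc hac hbc using fun j => (hD j).2 (a j) (ha j) (b j) (hb j)
    exact ⟨c, hc, specLE_iff.2 hac, specLE_iff.2 hbc⟩

theorem convergesTo_pi {D : Fin n → Set X} (hD : ∀ j, IsDirectedSet (D j))
    {a : DirectedPower X n} (h : ∀ j, ConvergesTo (D j) (a j)) :
    ConvergesTo {c : DirectedPower X n | ∀ j, c j ∈ D j} a := by
  refine (convergesTo_iff_pi (isDirectedSet_pi hD)).2 (convergesTo_iff.2 fun U hU ha => ?_)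
  obtain ⟨V, hV, hVU⟩ := isOpen_pi_iff'.1 hU a ha
  choose c hc hcV using fun j => convergesTo_iff.1 (h j) (V j) (hV j).1 (hV j).2
  exact ⟨c, hc, hVU fun j _ => hcV j⟩

theorem isDirectedSpace (hX : IsDirectedSpace X) : IsDirectedSpace (DirectedPower X n) := by
  have := hX.1
  constructor
  · refine ⟨fun a b hab => funext fun j => ?_⟩
    exact (hab.map (continuous_of_continuous_pi (continuous_apply j))).eq
  · intro U hU D x hD hDx hx
    exact hU D x (isDirectedSet_iff.2 hD)
      ((convergesTo_iff_pi (isDirectedSet_iff.2 hD)).2 hDx) hx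

/-- Forwards, test `a ≪ b` on the product of the way-below sets of the `b j`. Backwards, project `D`
to each coordinate and bound the finitely many witnesses in `D`. -/
theorem wayBelow_iff (hX : IsContinuousSpace X) {a b : DirectedPower X n} :
    WayBelow a b ↔ ∀ j, WayBelow (a j) (b j) := by
  constructor
  · intro h j
    obtain ⟨c, hc, hac⟩ := h _ (isDirectedSet_pi fun j => hX.isDirectedSet_wayBelow (b j))
      (convergesTo_pi (fun j => hX.isDirectedSet_wayBelow (b j))
        fun j => hX.convergesTo_wayBelow (b j))
    exact (specLE_iff.1 hac j).trans_wayBelow (hc j)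
  · intro h D hD hDb
    have key : ∀ j, ∃ d ∈ D, SpecLE (a j) (d j) := by
      intro j
      have hcont : Continuous fun d : DirectedPower X n => d j :=
        continuous_of_continuous_pi (continuous_apply j)
      obtain ⟨_, ⟨d, hd, rfl⟩, had⟩ := h j ((fun d : DirectedPower X n => d j) '' D)
        ⟨hD.1.image _, by
          rintro _ ⟨c, hc, rfl⟩ _ ⟨d, hd, rfl⟩
          obtain ⟨e, he, hce, hde⟩ := hD.2 c hc d hd
          exact ⟨_, ⟨e, he, rfl⟩, hce.map hcont, hde.map hcont⟩⟩
        (convergesTo_iff.2 fun U hU hb => by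
          obtain ⟨d, hd, hdU⟩ := convergesTo_iff.1 hDb _ (hU.preimage hcont) hb
          exact ⟨_, ⟨d, hd, rfl⟩, hdU⟩)
      exact ⟨d, hd, had⟩
    choose d hd had using key
    obtain ⟨e, he, hde⟩ := hD.exists_forall_specLE d hd
    exact ⟨e, he, specLE_iff.2 fun j => (had j).trans (specLE_iff.1 (hde j) j)⟩

theorem isContinuousSpace (hX : IsContinuousSpace X) :
    IsContinuousSpace (DirectedPower X n) := by
  refine ⟨isDirectedSpace hX.1, fun b => ⟨_, isDirectedSet_pi fun j =>
    hX.isDirectedSet_wayBelow (b j), fun c hc => (wayBelow_iff hX).2 hc,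
    convergesTo_pi (fun j => hX.isDirectedSet_wayBelow (b j))
        fun j => hX.convergesTo_wayBelow (b j)⟩⟩

end DirectedPower

/-! ### Terms over a continuous space: approximation, preorder and topology -/

namespace Signature.Term

variable {S : Signature.{u}} {X : Type u}

/-- Simultaneous substitution of terms for variables. -/
def subst {V : Type v} (σ : V → S.Term X) : S.Term V → S.Term X
  | .var x => σ x
  | .app i t => .app i fun j => (t j).subst σ

variable [TopologicalSpace X]

/-- Terms of the same shape whose variables are related by the way-below relation. -/
inductive Approx : S.Term X → S.Term X → Prop
  | var {x y : X} : WayBelow x y → Approx (.var x) (.var y)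
  | app {i : S.Op} {s t : Fin (S.arity i) → S.Term X} :
      (∀ j, Approx (s j) (t j)) → Approx (.app i s) (.app i t)

/-- The preorder on terms generated by the specialization order of `X` and the inequalities in
`E`. -/
inductive Le (E : Set (S.Term ℕ × S.Term ℕ)) : S.Term X → S.Term X → Prop
  | refl (t : S.Term X) : Le E t t
  | trans {s t u : S.Term X} : Le E s t → Le E t u → Le E s u
  | var {x y : X} : SpecLE x y → Le E (.var x) (.var y)
  | app {i : S.Op} {s t : Fin (S.arity i) → S.Term X} :
      (∀ j, Le E (s j) (t j)) → Le E (.app i s) (.app i t)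
  | ineq {p : S.Term ℕ × S.Term ℕ} (hp : p ∈ E) (σ : ℕ → S.Term X) :
      Le E (p.1.subst σ) (p.2.subst σ)

variable {E : Set (S.Term ℕ × S.Term ℕ)}

theorem approx_var_iff {s : S.Term X} {x : X} :
    Approx s (.var x) ↔ ∃ y, WayBelow y x ∧ s = .var y := by
  constructor
  · rintro (h | _)
    exact ⟨_, h, rfl⟩
  · rintro ⟨y, h, rfl⟩
    exact .var h

theorem approx_app_iff {s : S.Term X} {i : S.Op} {t : Fin (S.arity i) → S.Term X} :
    Approx s (.app i t) ↔ ∃ s', (∀ j, Approx (s' j) (t j)) ∧ s = .app i s' := by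
  constructor
  · rintro (_ | h)
    exact ⟨_, h, rfl⟩
  · rintro ⟨y, h, rfl⟩
    exact .app h

theorem Approx.le {s t : S.Term X} (h : Approx s t) : Le E s t := by
  induction h with
  | var h => exact .var h.specLE
  | app _ ih => exact .app ih

theorem Le.subst {V : Type v} {σ τ : V → S.Term X} (h : ∀ x, Le E (σ x) (τ x)) (t : S.Term V) :
    Le E (t.subst σ) (t.subst τ) := by
  induction t with
  | var x => exact h x
  | app i t ih => exact .app ih

theorem Approx.subst {V : Type v} {σ τ : V → S.Term X} (h : ∀ x, Approx (σ x) (τ x))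
    (t : S.Term V) : Approx (t.subst σ) (t.subst τ) := by
  induction t with
  | var x => exact h x
  | app i t ih => exact .app ih

theorem exists_approx (hX : IsContinuousSpace X) (t : S.Term X) : ∃ s, Approx s t := by
  induction t with
  | var x =>
    obtain ⟨y, hy⟩ := (hX.isDirectedSet_wayBelow x).1
    exact ⟨_, .var hy⟩
  | app i t ih =>
    choose s hs using ih
    exact ⟨_, .app hs⟩

theorem approx_directed (E : Set (S.Term ℕ × S.Term ℕ)) (hX : IsContinuousSpace X)
    (t a b : S.Term X) (ha : Approx a t) (hb : Approx b t) :
    ∃ c, Approx c t ∧ Le E a c ∧ Le E b c := by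
  induction t generalizing a b with
  | var x =>
    obtain ⟨a, ha', rfl⟩ := approx_var_iff.1 ha
    obtain ⟨b, hb', rfl⟩ := approx_var_iff.1 hb
    obtain ⟨c, hc, hac, hbc⟩ := (hX.isDirectedSet_wayBelow x).2 a ha' b hb'
    exact ⟨_, .var hc, .var hac, .var hbc⟩
  | app i t ih =>
    obtain ⟨a, ha', rfl⟩ := approx_app_iff.1 ha
    obtain ⟨b, hb', rfl⟩ := approx_app_iff.1 hb
    choose c hc hac hbc using fun j => ih j (a j) (b j) (ha' j) (hb' j)
    exact ⟨_, .app hc, .app hac, .app hbc⟩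

theorem Approx.interpolation (hX : IsContinuousSpace X) {s t : S.Term X} (h : Approx s t) :
    ∃ r, Approx s r ∧ Approx r t := by
  induction h with
  | var h =>
    obtain ⟨z, hz, hz'⟩ := hX.interpolation h
    exact ⟨_, .var hz, .var hz'⟩
  | app _ ih =>
    choose r hr hr' using ih
    exact ⟨_, .app hr, .app hr'⟩

/-- A term approximating a substitution instance lies below an instance of the same term at
approximations of the substituted terms. -/
theorem Approx.exists_subst (E : Set (S.Term ℕ × S.Term ℕ)) (hX : IsContinuousSpace X)
    {V : Type} (σ : V → S.Term X) (t : S.Term V)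
    {s : S.Term X} (h : Approx s (t.subst σ)) :
    ∃ τ : V → S.Term X, (∀ x, Approx (τ x) (σ x)) ∧ Le E s (t.subst τ) := by
  classical
  induction t generalizing s with
  | var x =>
    -- Only the value at `x` is prescribed; elsewhere any approximant will do.
    choose τ hτ using fun y => exists_approx hX (σ y)
    refine ⟨Function.update τ x s, fun y => ?_, ?_⟩
    · rcases eq_or_ne y x with rfl | hy
      · simpa [Term.subst] using h
      · simpa [hy] using hτ y
    · simpa [Term.subst] using Le.refl s
  | app i t ih =>
    obtain ⟨s, hs, rfl⟩ := approx_app_iff.1 h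
    choose τ hτ hle using fun j => ih j (hs j)
    -- A variable may occur in several arguments, each giving its own approximant of `σ x`;
    -- directedness merges these finitely many into one.
    choose ρ hρ hτρ using fun x => exists_forall_rel_of_directed (r := Le E)
      (P := fun s => Approx s (σ x)) Le.trans (exists_approx hX (σ x))
      (approx_directed E hX (σ x)) (fun j => τ j x) fun j => hτ j x
    exact ⟨ρ, hρ, .app fun j => (hle j).trans (Le.subst (fun x => hτρ x j) (t j))⟩

/-- Approximation followed by `≤` can be replaced by `≤` followed by approximation. -/
theorem Le.exists_approx (hX : IsContinuousSpace X) {s t u : S.Term X} (h : Le E t u)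
    (hs : Approx s t) : ∃ r, Le E s r ∧ Approx r u := by
  induction h generalizing s with
  | refl t => exact ⟨s, .refl s, hs⟩
  | trans _ _ ih ih' =>
    obtain ⟨r, hsr, hr⟩ := ih hs
    obtain ⟨q, hrq, hq⟩ := ih' hr
    exact ⟨q, hsr.trans hrq, hq⟩
  | var h =>
    obtain ⟨y, hy, rfl⟩ := approx_var_iff.1 hs
    exact ⟨_, .refl _, .var (hy.trans_specLE h)⟩
  | app _ ih =>
    obtain ⟨s, hs', rfl⟩ := approx_app_iff.1 hs
    choose r hsr hr using fun j => ih j (hs' j)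
    exact ⟨_, .app hsr, .app hr⟩
  -- The inequality is applied at the approximating substitution `τ` instead of `σ`.
  | @ineq p hp σ =>
    obtain ⟨τ, hτ, hle⟩ := Approx.exists_subst E hX σ p.1 hs
    exact ⟨_, hle.trans (.ineq hp τ), Approx.subst hτ p.2⟩

/-- `s` lies below an approximation of `t`. -/
def Below (E : Set (S.Term ℕ × S.Term ℕ)) (s t : S.Term X) : Prop := ∃ r, Le E s r ∧ Approx r t

theorem Below.le {s t : S.Term X} (h : Below E s t) : Le E s t := by
  obtain ⟨r, hsr, hr⟩ := h
  exact hsr.trans hr.le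

theorem Below.trans_le (hX : IsContinuousSpace X) {s t u : S.Term X} (h : Below E s t)
    (h' : Le E t u) : Below E s u := by
  obtain ⟨r, hsr, hr⟩ := h
  obtain ⟨q, hrq, hq⟩ := h'.exists_approx hX hr
  exact ⟨q, hsr.trans hrq, hq⟩

theorem Below.app {i : S.Op} {s t : Fin (S.arity i) → S.Term X} (h : ∀ j, Below E (s j) (t j)) :
    Below E (.app i s) (.app i t) := by
  choose r hsr hr using h
  exact ⟨_, .app hsr, .app hr⟩

/-- The topology on terms whose open sets are the upper sets that contain, with each term, one of
its approximations. -/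
@[reducible] def topology (E : Set (S.Term ℕ × S.Term ℕ)) (hX : IsContinuousSpace X) :
    TopologicalSpace (S.Term X) where
  IsOpen U := (∀ s t, Le E s t → s ∈ U → t ∈ U) ∧ ∀ t ∈ U, ∃ s ∈ U, Approx s t
  isOpen_univ := ⟨fun _ _ _ _ => trivial, fun t _ =>
    let ⟨s, hs⟩ := Term.exists_approx hX t
    ⟨s, trivial, hs⟩⟩
  isOpen_inter := by
    rintro U V ⟨hU, hU'⟩ ⟨hV, hV'⟩
    refine ⟨fun s t h hs => ⟨hU s t h hs.1, hV s t h hs.2⟩, fun t ht => ?_⟩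
    obtain ⟨a, haU, ha⟩ := hU' t ht.1
    obtain ⟨b, hbV, hb⟩ := hV' t ht.2
    obtain ⟨c, hc, hac, hbc⟩ := approx_directed E hX t a b ha hb
    exact ⟨c, ⟨hU _ _ hac haU, hV _ _ hbc hbV⟩, hc⟩
  isOpen_sUnion := by
    rintro 𝒰 h
    refine ⟨?_, ?_⟩
    · rintro s t hst ⟨U, hU, hs⟩
      exact ⟨U, hU, (h U hU).1 s t hst hs⟩
    · rintro t ⟨U, hU, ht⟩
      obtain ⟨s, hs, hst⟩ := (h U hU).2 t ht
      exact ⟨s, ⟨U, hU, hs⟩, hst⟩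

/-- Upward closure is `Le.exists_approx`; the approximant required inside the set comes from
interpolation. -/
theorem isOpen_below (hX : IsContinuousSpace X) (s : S.Term X) :
    @IsOpen _ (topology E hX) {t | Below E s t} := by
  refine ⟨fun t u htu hst => hst.trans_le hX htu, ?_⟩
  rintro t ⟨r, hsr, hr⟩
  obtain ⟨q, hrq, hq⟩ := hr.interpolation hX
  exact ⟨q, ⟨r, hsr, hrq⟩, hq⟩

theorem specLE_iff (hX : IsContinuousSpace X) {s t : S.Term X} :
    @SpecLE _ (topology E hX) s t ↔ ∀ r, Approx r s → Below E r t := by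
  let _ := topology E hX
  constructor
  · intro h r hr
    exact h.mem_of_isOpen (isOpen_below hX r) ⟨r, .refl r, hr⟩
  · intro h
    refine mem_closure_iff.2 fun U hU hs => ⟨t, ?_, rfl⟩
    obtain ⟨r, hrU, hr⟩ := hU.2 s hs
    exact hU.1 _ _ (h r hr).le hrU

theorem Le.specLE (hX : IsContinuousSpace X) {s t : S.Term X} (h : Le E s t) :
    @SpecLE _ (topology E hX) s t :=
  (specLE_iff hX).2 fun _ hr => h.exists_approx hX hr

/-- Makes the operations well defined and monotone on the T₀ quotient. -/
theorem specLE_app (hX : IsContinuousSpace X) {i : S.Op} {s t : Fin (S.arity i) → S.Term X}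
    (h : ∀ j, @SpecLE _ (topology E hX) (s j) (t j)) :
    @SpecLE _ (topology E hX) (.app i s) (.app i t) := by
  refine (specLE_iff hX).2 fun r hr => ?_
  obtain ⟨r, hr', rfl⟩ := approx_app_iff.1 hr
  exact .app fun j => (specLE_iff hX).1 (h j) _ (hr' j)

theorem continuous_var (hX : IsContinuousSpace X) :
    @Continuous _ _ _ (topology E hX) (Term.var : X → S.Term X) := by
  let _ := topology E hX
  refine ⟨fun U hU => hX.1.2 _ fun D x hD hDx hx => ?_⟩
  obtain ⟨s, hsU, hs⟩ := hU.2 _ hx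
  obtain ⟨y, hy, rfl⟩ := approx_var_iff.1 hs
  obtain ⟨d, hd, hyd⟩ := hy D hD hDx
  exact ⟨d, hd, hU.1 _ _ (.var hyd) hsU⟩

end Signature.Term

/-! ### Evaluation of terms in an algebra -/

namespace Algebra

open Signature Signature.Term

variable {S : Signature.{u}} {E : Set (S.Term ℕ × S.Term ℕ)} {X : Type u}

theorem eval_subst (A : Algebra S) {V : Type v} (σ : V → S.Term X) (f : X → A.carrier)
    (t : S.Term V) : A.eval f (t.subst σ) = A.eval (fun x => A.eval f (σ x)) t := by
  induction t with
  | var x => rfl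
  | app i t ih => exact congrArg (A.op i) (funext ih)

theorem IsHom.map_eval {A B : Algebra S} {h : A.carrier → B.carrier} (hh : IsHom A B h)
    {V : Type v} (f : V → A.carrier) (t : S.Term V) : h (A.eval f t) = B.eval (h ∘ f) t := by
  induction t with
  | var x => rfl
  | app i t ih => exact (hh.2 i _).trans (congrArg (B.op i) (funext ih))

theorem op_specLE (A : Algebra S) {i : S.Op} {a b : DirectedPower A.carrier (S.arity i)}
    (h : ∀ j, SpecLE (a j) (b j)) : SpecLE (A.op i a) (A.op i b) :=
  (DirectedPower.specLE_iff.2 h).map (A.continuous_op i)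

variable [TopologicalSpace X]

theorem eval_specLE {A : Algebra S} (hA : A.Satisfies E) {f : X → A.carrier} (hf : Continuous f)
    {s t : S.Term X} (h : Le E s t) : SpecLE (A.eval f s) (A.eval f t) := by
  induction h with
  | refl => exact SpecLE.refl _
  | trans _ _ ih ih' => exact ih.trans ih'
  | var h => exact h.map hf
  | app _ ih => exact A.op_specLE ih
  | @ineq p hp σ =>
    rw [eval_subst, eval_subst]
    exact hA p hp _

theorem isDirectedSet_eval_approx {A : Algebra S} (hA : A.Satisfies E) {f : X → A.carrier}
    (hf : Continuous f) (hX : IsContinuousSpace X) (t : S.Term X) :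
    IsDirectedSet (A.eval f '' {s | Approx s t}) := by
  constructor
  · obtain ⟨s, hs⟩ := exists_approx hX t
    exact ⟨_, s, hs, rfl⟩
  · rintro _ ⟨a, ha, rfl⟩ _ ⟨b, hb, rfl⟩
    obtain ⟨c, hc, hac, hbc⟩ := approx_directed E hX t a b ha hb
    exact ⟨_, ⟨c, hc, rfl⟩, eval_specLE hA hf hac, eval_specLE hA hf hbc⟩

/-- Induction on `t`: the product of the convergent directed sets of the arguments converges in the
directed power, where the operation is continuous. -/
theorem convergesTo_eval_approx {A : Algebra S} (hA : A.Satisfies E) {f : X → A.carrier}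
    (hf : Continuous f) (hX : IsContinuousSpace X) (t : S.Term X) :
    ConvergesTo (A.eval f '' {s | Approx s t}) (A.eval f t) := by
  induction t with
  | var x =>
    refine convergesTo_iff.2 fun U hU hx => ?_
    obtain ⟨y, hy, hyU⟩ := convergesTo_iff.1 (hX.convergesTo_wayBelow x) _ (hU.preimage hf) hx
    exact ⟨_, ⟨_, .var hy, rfl⟩, hyU⟩
  | app i t ih =>
    refine convergesTo_iff.2 fun U hU hx => ?_
    obtain ⟨c, hc, hcU⟩ := convergesTo_iff.1
      (DirectedPower.convergesTo_pi (fun j => isDirectedSet_eval_approx hA hf hX (t j)) ih) _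
      (hU.preimage (A.continuous_op i)) hx
    choose s hs hsc using hc
    refine ⟨_, ⟨_, .app hs, rfl⟩, ?_⟩
    have : (fun j => A.eval f (s j)) = c := funext hsc
    change A.op i (fun j => A.eval f (s j)) ∈ U
    rw [this]
    exact hcU

theorem continuous_eval {A : Algebra S} (hA : A.Satisfies E) {f : X → A.carrier}
    (hf : Continuous f) (hX : IsContinuousSpace X) :
    @Continuous _ _ (topology E hX) _ (A.eval f) := by
  let _ := topology E hX
  refine ⟨fun U hU => ⟨fun s t hst hs => (eval_specLE hA hf hst).mem_of_isOpen hU hs,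
    fun t ht => ?_⟩⟩
  obtain ⟨_, ⟨s, hs, rfl⟩, hsU⟩ := convergesTo_iff.1 (convergesTo_eval_approx hA hf hX t) U hU ht
  exact ⟨s, hsU, hs⟩

/-- The `T₀` quotient of the space of terms over `X`. -/
def FreeCarrier (E : Set (S.Term ℕ × S.Term ℕ)) (hX : IsContinuousSpace X) : Type u :=
  @SeparationQuotient (S.Term X) (topology E hX)

namespace FreeCarrier

variable (hX : IsContinuousSpace X)

instance : TopologicalSpace (FreeCarrier E hX) :=
  @instTopologicalSpaceSeparationQuotient _ (topology E hX)

/-- The class of a term. -/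
def mk (E : Set (S.Term ℕ × S.Term ℕ)) (hX : IsContinuousSpace X) (t : S.Term X) :
    FreeCarrier E hX :=
  @SeparationQuotient.mk _ (topology E hX) t

theorem surjective_mk : Function.Surjective (mk E hX) :=
  @SeparationQuotient.surjective_mk _ (topology E hX)

theorem isInducing_mk : @Topology.IsInducing _ _ (topology E hX) _ (mk E hX) :=
  @SeparationQuotient.isInducing_mk _ (topology E hX)

end FreeCarrier

/-! ### Spaces presented by terms through an inducing map -/

section Inducing

variable {Y : Type u} [TopologicalSpace Y] {q : S.Term X → Y} (hX : IsContinuousSpace X)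

theorem specLE_of_isInducing
    (hq : @Topology.IsInducing _ _ (topology E hX) _ q)
    {s t : S.Term X} :
    SpecLE (q s) (q t) ↔ @SpecLE _ (topology E hX) s t := by
  let _ := topology E hX
  rw [specLE_iff_specializes, specLE_iff_specializes, hq.specializes_iff]

/-- The open set of terms `Below`-above `s` is the preimage of an open set of `Y`. A directed set
converging to `q t` must meet it, at a point above `q s`. -/
theorem wayBelow_of_isInducing
    (hq : @Topology.IsInducing _ _ (topology E hX) _ q)
    (hs : Function.Surjective q) {s t : S.Term X} (h : Approx s t) :
    WayBelow (q s) (q t) := by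
  let _ := topology E hX
  intro D _ hDt
  obtain ⟨V, hV, hVs⟩ := hq.isOpen_iff.1 (isOpen_below (E := E) hX s)
  have hmem : ∀ u, q u ∈ V ↔ Below E s u := fun u => by
    rw [← Set.mem_preimage, hVs]; rfl
  obtain ⟨d, hd, hdV⟩ := convergesTo_iff.1 hDt V hV ((hmem t).2 ⟨s, .refl s, h⟩)
  obtain ⟨u, rfl⟩ := hs d
  exact ⟨_, hd, (specLE_of_isInducing hX hq).2 (((hmem u).1 hdV).le.specLE hX)⟩

theorem isDirectedSet_image_approx
    (hq : @Topology.IsInducing _ _ (topology E hX) _ q)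
    (t : S.Term X) : IsDirectedSet (q '' {s | Approx s t}) := by
  constructor
  · obtain ⟨s, hs⟩ := exists_approx hX t
    exact ⟨_, s, hs, rfl⟩
  · rintro _ ⟨a, ha, rfl⟩ _ ⟨b, hb, rfl⟩
    obtain ⟨c, hc, hac, hbc⟩ := approx_directed E hX t a b ha hb
    exact ⟨_, ⟨c, hc, rfl⟩, (specLE_of_isInducing hX hq).2 (hac.specLE hX),
      (specLE_of_isInducing hX hq).2 (hbc.specLE hX)⟩

theorem convergesTo_image_approx
    (hq : @Topology.IsInducing _ _ (topology E hX) _ q)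
    (t : S.Term X) :
    ConvergesTo (q '' {s | Approx s t}) (q t) := by
  let _ := topology E hX
  refine convergesTo_iff.2 fun U hU ht => ?_
  obtain ⟨s, hsU, hs⟩ := (hU.preimage hq.continuous).2 t ht
  exact ⟨_, ⟨s, hs, rfl⟩, hsU⟩

/-- Images of approximants give the required directed sets. Stated for general `q` so as to serve
both the quotient map and evaluation in an arbitrary free algebra. -/
theorem isContinuousSpace_of_isInducing
    (hq : @Topology.IsInducing _ _ (topology E hX) _ q)
    (hs : Function.Surjective q) [T0Space Y] :
    IsContinuousSpace Y := by
  let _ := topology E hX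
  refine ⟨⟨inferInstance, fun U hU => ?_⟩, fun y => ?_⟩
  · have hpre : IsOpen (q ⁻¹' U) := by
      refine ⟨fun s t hst hs => hU.mem_of_specLE
        ((specLE_of_isInducing hX hq).2 (hst.specLE hX)) hs, fun t ht => ?_⟩
      obtain ⟨_, ⟨s, hs, rfl⟩, hsU⟩ := hU _ _ (isDirectedSet_image_approx hX hq t)
        (convergesTo_image_approx hX hq t) ht
      exact ⟨s, hsU, hs⟩
    obtain ⟨V, hV, hVU⟩ := hq.isOpen_iff.1 hpre
    rwa [← hs.preimage_injective hVU]
  · obtain ⟨t, rfl⟩ := hs y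
    refine ⟨_, isDirectedSet_image_approx hX hq t, ?_, convergesTo_image_approx hX hq t⟩
    rintro _ ⟨s, hst, rfl⟩
    exact wayBelow_of_isInducing hX hq hs hst

theorem exists_approx_of_wayBelow
    (hq : @Topology.IsInducing _ _ (topology E hX) _ q)
    {y : Y} {t : S.Term X} (h : WayBelow y (q t)) :
    ∃ s, Approx s t ∧ SpecLE y (q s) := by
  obtain ⟨_, ⟨s, hs, rfl⟩, hys⟩ := h _ (isDirectedSet_image_approx hX hq t)
    (convergesTo_image_approx hX hq t)
  exact ⟨s, hs, hys⟩

end Inducing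

/-! ### The algebra structure on classes of terms and its universal property -/

namespace FreeCarrier

variable (hX : IsContinuousSpace X)

instance : T0Space (FreeCarrier E hX) :=
  @SeparationQuotient.instT0Space _ (topology E hX)

theorem isContinuousSpace : IsContinuousSpace (FreeCarrier E hX) :=
  isContinuousSpace_of_isInducing hX (isInducing_mk hX) (surjective_mk hX)

/-- The operations on classes of terms. -/
noncomputable def op (i : S.Op) (a : DirectedPower (FreeCarrier E hX) (S.arity i)) : FreeCarrier E hX :=
  mk E hX (.app i fun j => Function.surjInv (surjective_mk hX) (a j))

theorem specLE_mk_app {i : S.Op} {s t : Fin (S.arity i) → S.Term X}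
    (h : ∀ j, SpecLE (mk E hX (s j)) (mk E hX (t j))) :
    SpecLE (mk E hX (.app i s)) (mk E hX (.app i t)) :=
  (specLE_of_isInducing hX (isInducing_mk hX)).2 <|
    specLE_app hX fun j => (specLE_of_isInducing hX (isInducing_mk hX)).1 (h j)

theorem op_mk (i : S.Op) (t : Fin (S.arity i) → S.Term X) :
    op hX i (fun j => mk E hX (t j)) = mk E hX (.app i t) := by
  have h : ∀ j, mk E hX (Function.surjInv (surjective_mk hX) (mk E hX (t j))) = mk E hX (t j) :=
    fun j => Function.surjInv_eq _ _
  apply SpecLE.antisymm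
  · exact specLE_mk_app hX fun j => by rw [h]; exact SpecLE.refl _
  · exact specLE_mk_app hX fun j => by rw [h]; exact SpecLE.refl _

theorem continuous_op (i : S.Op) : Continuous (op (E := E) hX i) := by
  let _ := topology E hX
  refine ⟨fun U hU D a hD hDa ha => ?_⟩
  obtain ⟨t, rfl⟩ : ∃ t : Fin (S.arity i) → S.Term X, a = fun j => mk E hX (t j) := by
    choose t ht using fun j => surjective_mk hX (a j)
    exact ⟨t, funext fun j => (ht j).symm⟩
  have hD' := DirectedPower.isDirectedSet_iff.2 hD
  replace ha : op hX i (fun j => mk E hX (t j)) ∈ U := ha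
  rw [op_mk] at ha
  obtain ⟨s, hsU, hs⟩ := (hU.preimage (isInducing_mk hX).continuous).2 _ ha
  obtain ⟨s, hs', rfl⟩ := approx_app_iff.1 hs
  -- The classes of the `s j` form a tuple way below `a`, so some `d ∈ D` dominates it.
  obtain ⟨d, hd, hsd⟩ := (DirectedPower.wayBelow_iff (isContinuousSpace hX)).2
    (fun j => wayBelow_of_isInducing hX (isInducing_mk hX) (surjective_mk hX) (hs' j)) D hD'
    ((DirectedPower.convergesTo_iff_pi hD').2 hDa)
  refine ⟨d, hd, ?_⟩
  obtain ⟨u, rfl⟩ : ∃ u : Fin (S.arity i) → S.Term X, d = fun j => mk E hX (u j) := by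
    choose t ht using fun j => surjective_mk hX (d j)
    exact ⟨t, funext fun j => (ht j).symm⟩
  change op hX i (fun j => mk E hX (u j)) ∈ U
  rw [op_mk]
  exact (specLE_mk_app hX (DirectedPower.specLE_iff.1 hsd)).mem_of_isOpen hU hsU

end FreeCarrier

/-- The free algebra over a continuous space. -/
@[reducible] noncomputable def free (E : Set (S.Term ℕ × S.Term ℕ)) (hX : IsContinuousSpace X) : Algebra S where
  carrier := FreeCarrier E hX
  isDirectedSpace := (FreeCarrier.isContinuousSpace hX).1
  op := FreeCarrier.op hX
  continuous_op := FreeCarrier.continuous_op hX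

theorem free_eval_mk (hX : IsContinuousSpace X) {V : Type v} (σ : V → S.Term X) (t : S.Term V) :
    (free E hX).eval (fun x => FreeCarrier.mk E hX (σ x)) t =
      FreeCarrier.mk E hX (t.subst σ) := by
  induction t with
  | var x => rfl
  | app i t ih =>
    exact (congrArg (FreeCarrier.op hX i) (funext ih)).trans (FreeCarrier.op_mk hX i _)

theorem free_satisfies (hX : IsContinuousSpace X) : (free E hX).Satisfies E := by
  intro p hp h
  obtain ⟨σ, rfl⟩ : ∃ σ : ℕ → S.Term X, h = fun n => FreeCarrier.mk E hX (σ n) := by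
    choose t ht using fun n => FreeCarrier.surjective_mk hX (h n)
    exact ⟨t, funext fun n => (ht n).symm⟩
  rw [free_eval_mk, free_eval_mk]
  exact (specLE_of_isInducing hX (FreeCarrier.isInducing_mk hX)).2 ((Le.ineq hp σ).specLE hX)

/-- The unit of the free algebra. -/
def freeUnit (E : Set (S.Term ℕ × S.Term ℕ)) (hX : IsContinuousSpace X) (x : X) :
    (free E hX).carrier :=
  FreeCarrier.mk E hX (.var x)

theorem eval_freeUnit (hX : IsContinuousSpace X) :
    (free E hX).eval (freeUnit E hX) = FreeCarrier.mk E hX := by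
  funext t
  induction t with
  | var x => rfl
  | app i t ih =>
    exact (congrArg (FreeCarrier.op hX i) (funext ih)).trans (FreeCarrier.op_mk hX i _)

theorem isFree_free (hX : IsContinuousSpace X) : (free E hX).IsFree E (freeUnit E hX) := by
  let _ := topology E hX
  refine ⟨free_satisfies hX,
    (FreeCarrier.isInducing_mk hX).continuous.comp (continuous_var hX), fun B hB f hf => ?_⟩
  have := B.isDirectedSpace.1
  have hc : Continuous (B.eval f) := continuous_eval hB hf hX
  -- Evaluation factors through the quotient because `B` is T₀.
  have hinv : ∀ s t : S.Term X, Inseparable s t → B.eval f s = B.eval f t :=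
    fun s t hst => (hst.map hc).eq
  let h : (free E hX).carrier → B.carrier := SeparationQuotient.lift (B.eval f) hinv
  have hmk : ∀ t, h (FreeCarrier.mk E hX t) = B.eval f t := fun _ => rfl
  refine ⟨h, ⟨⟨SeparationQuotient.continuous_lift hc, fun i a => ?_⟩, rfl⟩, ?_⟩
  · obtain ⟨t, rfl⟩ : ∃ t : Fin (S.arity i) → S.Term X, a = fun j => FreeCarrier.mk E hX (t j) := by
      choose t ht using fun j => FreeCarrier.surjective_mk hX (a j)
      exact ⟨t, funext fun j => (ht j).symm⟩
    exact congrArg h (FreeCarrier.op_mk hX i t)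
  -- Uniqueness: each element is the value of a term at the unit.
  · rintro g ⟨hg, rfl⟩
    funext a
    obtain ⟨t, rfl⟩ := FreeCarrier.surjective_mk hX a
    rw [hmk, ← hg.map_eval, eval_freeUnit]

/-! ### Transfer to arbitrary free algebras -/

theorem isHom_id (A : Algebra S) : IsHom A A id := ⟨continuous_id, fun _ _ => rfl⟩

theorem IsHom.comp {A B C : Algebra S} {g : B.carrier → C.carrier} {f : A.carrier → B.carrier}
    (hg : IsHom B C g) (hf : IsHom A B f) : IsHom A C (g ∘ f) :=
  ⟨hg.1.comp hf.1, fun i a => (congrArg g (hf.2 i a)).trans (hg.2 i _)⟩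

/-- Free algebras over the same space are isomorphic. -/
theorem IsFree.exists_homeomorph {A B : Algebra S} {η : X → A.carrier} {θ : X → B.carrier}
    (hA : A.IsFree E η) (hB : B.IsFree E θ) :
    ∃ e : A.carrier ≃ₜ B.carrier, IsHom A B e ∧ e ∘ η = θ := by
  obtain ⟨f, ⟨hf, hfη⟩, -⟩ := hA.2.2 B hB.1 θ hB.2.1
  obtain ⟨g, ⟨hg, hgθ⟩, -⟩ := hB.2.2 A hA.1 η hA.2.1
  have hgf : g ∘ f = id := (hA.2.2 A hA.1 η hA.2.1).unique
    ⟨hg.comp hf, by rw [Function.comp_assoc, hfη, hgθ]⟩ ⟨isHom_id A, rfl⟩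
  have hfg : f ∘ g = id := (hB.2.2 B hB.1 θ hB.2.1).unique
    ⟨hf.comp hg, by rw [Function.comp_assoc, hgθ, hfη]⟩ ⟨isHom_id B, rfl⟩
  exact ⟨⟨⟨f, g, congrFun hgf, congrFun hfg⟩, hf.1, hg.1⟩, hf, hfη⟩

/-- Every free algebra over a continuous space is presented by the space of terms. -/
theorem IsFree.eval_surjective_and_isInducing {A : Algebra S} {η : X → A.carrier}
    (hA : A.IsFree E η) (hX : IsContinuousSpace X) :
    Function.Surjective (A.eval η) ∧ @Topology.IsInducing _ _ (topology E hX) _ (A.eval η) := by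
  let _ := topology E hX
  obtain ⟨e, he, rfl⟩ := (isFree_free hX).exists_homeomorph hA
  have heval : A.eval (e ∘ freeUnit E hX) = e ∘ FreeCarrier.mk E hX := by
    funext t
    rw [← he.map_eval, eval_freeUnit]
    rfl
  rw [heval]
  exact ⟨e.surjective.comp (FreeCarrier.surjective_mk hX),
    e.isInducing.comp (FreeCarrier.isInducing_mk hX)⟩

/-- For the operations: if `a ≪ b` and `b` is the value of terms `t j`, each `a j` lies below the
value of an approximant `s j`, and `Approx` is closed under `app`. -/
theorem IsFree.wayBelowPreserving {A : Algebra S} {η : X → A.carrier} (hA : A.IsFree E η)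
    (hX : IsContinuousSpace X) :
    IsContinuousSpace A.carrier ∧ WayBelowPreserving η ∧ ∀ i, WayBelowPreserving (A.op i) := by
  obtain ⟨hs, hq⟩ := hA.eval_surjective_and_isInducing hX
  have := A.isDirectedSpace.1
  have hc : IsContinuousSpace A.carrier := isContinuousSpace_of_isInducing hX hq hs
  refine ⟨hc, ⟨hX, hc, hA.2.1, fun x y hxy => wayBelow_of_isInducing hX hq hs (.var hxy)⟩,
    fun i => ⟨DirectedPower.isContinuousSpace hc, hc, A.continuous_op i, fun a b hab => ?_⟩⟩
  obtain ⟨t, rfl⟩ : ∃ t : Fin (S.arity i) → S.Term X, b = fun j => A.eval η (t j) := by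
    choose t ht using fun j => hs (b j)
    exact ⟨t, funext fun j => (ht j).symm⟩
  choose s hst has using fun j =>
    exists_approx_of_wayBelow hX hq ((DirectedPower.wayBelow_iff hc).1 hab j)
  exact (A.op_specLE has).trans_wayBelow
    (wayBelow_of_isInducing (s := .app i s) (t := .app i t) hX hq hs (.app hst))

end Algebra

end DTop

theorem mainTheorem3 (S : DTop.Signature.{u}) (E : Set (S.Term ℕ × S.Term ℕ))
    (X : Type u) [TopologicalSpace X] (hX : DTop.IsContinuousSpace X) :
    (∃ (A : DTop.Algebra S) (η : X → A.carrier), A.IsFree E η) ∧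
      ∀ (A : DTop.Algebra S) (η : X → A.carrier), A.IsFree E η →
        DTop.IsContinuousSpace A.carrier ∧ DTop.WayBelowPreserving η ∧
          ∀ i : S.Op, DTop.WayBelowPreserving (A.op i) :=
  ⟨⟨DTop.Algebra.free E hX, DTop.Algebra.freeUnit E hX, DTop.Algebra.isFree_free hX⟩,
    fun _ _ hA => hA.wayBelowPreserving hX⟩
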